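/- Let $\Sigma=\{0,1\}$. A \emph{group oracle} is a family $B=\{B_n\}_{n\in\mathbb N}$ of bijections $B_n:\Sigma^{2n+2}\to\Sigma^{2n+2}$ such that for every $n$ there are a group $G_n$ and a one-to-one map $f_n:G_n\to\Sigma^n$ with the following property. Write the strings of $\Sigma^{2n+2}$ as $(c,b,x,y)$ with $c,b\in\Sigma$ and $x,y\in\Sigma^n$. If $x=f_n(g)$ and $y=f_n(h)$ with $g,h\in G_n$, then $B_n(0,b,x,y)=(0,b,x,f_n(hg))$ and $B_n(1,b,x,y)=(1,b,x,f_n(hg^{-1}))$; if $x$ or $y$ is not in $f_n(G_n)$, then $B_n(c,b,x,y)=(c,\neg b,x,y)$. $\mathrm{GNM}(B)\subseteq\Sigma^*$ (Group Non-Membership) is the language of binary encodings of all lists $f_n(g_1),\dots,f_n(g_k),f_n(h)$ with $n,k\in\mathbb N$ and $g_1,\dots,g_k,h\in G_n$ such that $h\notin\langle g_1,\dots,g_k\rangle$. The encoding of a list $w_1,\dots,w_k,w\in\Sigma^n$ is $1^k0\,1^n0\,w_1\cdots w_k w$. A language $A\subseteq\Sigma^*$ is in $\mathrm{MA}^B$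 if there are a predicate $R:(\Sigma^*)^3\to\{0,1\}$, computable in polynomial time by a deterministic Turing machine with access to $B$ (one step replaces a query string $w\in\Sigma^{2n+2}$, for any $n$, by $B_n(w)$), and polynomials $q$ and $r$ with natural-number coefficients, $q$ not the zero polynomial, such that for every $x\in\Sigma^*$: - if $x\in A$, then there is $y\in\Sigma^{q(|x|)}$ with $\left|\{z\in\Sigma^{r(|x|)} : R(x,y,z)=1\}\right|=2^{r(|x|)}$; - if $x\notin A$, then for all $y\in\Sigma^{q(|x|)}$, $\left|\{z\in\Sigma^{r(|x|)} : R(x,y,z)=1\}\right|<2^{-2q(|x|)}\,2^{r(|x|)}$. Theorem. There exists a group oracle $B$ such that $\mathrm{GNM}(B)\notin\mathrm{MA}^B$. -/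

import Mathlib

open Polynomial

namespace BlackBox

/-- The set `Σⁿ` of binary strings of length `n`. -/
abbrev Str (n : ℕ) : Type := List.Vector Bool n

/-! ### Group oracles -/

/-- The string of length `2n + 2` that consists of a control bit `c`, an error bit `b` and two
strings `x`, `y` of length `n`. Every string of length `2n + 2` is of this form, uniquely. -/
def quad {n : ℕ} (c b : Bool) (x y : Str n) : Str (2 * n + 2) :=
  ⟨c :: b :: (x.toList ++ y.toList), by
    simp only [List.length_cons, List.length_append, List.Vector.toList_length]; omega⟩

/-- The function `β` on `Σ^{2n+2}` is the multiplication gate of the group `G` whose elements are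
encoded by the one-to-one map `f : G → Σⁿ`. If `x = f g` and `y = f h`, the gate replaces `y` by
the encoding of `h * g` (control bit `0`) or of `h * g⁻¹` (control bit `1`); if `x` or `y` does not
encode a group element, it negates the error bit. -/
def Realizes {n : ℕ} {G : Type} [Group G] (β : Str (2 * n + 2) → Str (2 * n + 2))
    (f : G → Str n) : Prop :=
  Function.Injective f ∧
  (∀ (c b : Bool) (g h : G),
    β (quad c b (f g) (f h)) = quad c b (f g) (f (if c then h * g⁻¹ else h * g))) ∧
  (∀ (c b : Bool) (x y : Str n), (x ∉ Set.range f ∨ y ∉ Set.range f) →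
    β (quad c b x y) = quad c (!b) x y)

/-- A group oracle: a family of bijections `Bₙ : Σ^{2n+2} → Σ^{2n+2}`, each of which is the
multiplication gate of some group encoded by strings of length `n`. -/
structure GroupOracle where
  gate : (n : ℕ) → Equiv.Perm (Str (2 * n + 2))
  exists_group : ∀ n : ℕ, ∃ (G : Type) (_ : Group G) (f : G → Str n), Realizes (gate n) f

/-- The answer of the oracle to a query string `w`: it is `Bₙ(w)` if `w` has length `2n + 2`;
strings of any other length are returned unchanged. -/
def GroupOracle.answer (B : GroupOracle) (w : List Bool) : List Bool :=
  if hw : w.length = 2 * ((w.length - 2) / 2) + 2 then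
    (B.gate ((w.length - 2) / 2) ⟨w, hw⟩).toList
  else w

/-! ### Group non-membership -/

/-- The strings `gs = g₁, …, g_k` and `h` of length `n` all encode elements of the group of `Bₙ`,
and the element `h` lies outside the subgroup generated by `g₁, …, g_k`. -/
def GroupOracle.NonMember (B : GroupOracle) (n : ℕ) (gs : List (Str n)) (h : Str n) : Prop :=
  ∃ (G : Type) (_ : Group G) (f : G → Str n), Realizes (B.gate n) f ∧
    ∃ (us : List G) (v : G), us.map f = gs ∧ f v = h ∧ v ∉ Subgroup.closure {u : G | u ∈ us}

/-- Binary encoding `1ᵏ 0 1ⁿ 0 g₁ … g_k h` of an instance `g₁, …, g_k, h ∈ Σⁿ`. -/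
def encodeInstance {n : ℕ} (gs : List (Str n)) (h : Str n) : List Bool :=
  List.replicate gs.length true ++ false :: (List.replicate n true ++
    false :: ((gs.map List.Vector.toList).flatten ++ h.toList))

/-- The language of (encodings of) all positive instances of Group Non-Membership relative to the
group oracle `B`. -/
def GNM (B : GroupOracle) : Language Bool :=
  {x | ∃ (n : ℕ) (gs : List (Str n)) (h : Str n), B.NonMember n gs h ∧ x = encodeInstance gs h}

/-! ### Deterministic oracle Turing machines -/

/-- Tape symbols: the blank (`none`), the two bits, and `a` further symbols. -/
abbrev Sym (a : ℕ) : Type := Option (Bool ⊕ Fin a)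

/-- The tape symbol of a bit. -/
def Sym.bit {a : ℕ} (b : Bool) : Sym a := some (Sum.inl b)

/-- A two-way infinite tape, blank outside a finite part. `right` lists the symbols from the scanned
cell to the right, `left` the symbols from the cell left of the scanned one to the left. -/
structure Tape (a : ℕ) where
  left : List (Sym a)
  right : List (Sym a)

namespace Tape

variable {a : ℕ}

/-- The tape with the word `w` written on it, the head being on the first symbol of `w`. -/
def init (w : List Bool) : Tape a := ⟨[], w.map Sym.bit⟩

/-- The scanned symbol. -/
def read (T : Tape a) : Sym a := T.right.headD none

/-- Overwrite the scanned symbol. -/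
def write (s : Sym a) (T : Tape a) : Tape a := ⟨T.left, s :: T.right.tail⟩

/-- Move the head by one cell, or leave it where it is (`none`). -/
def move : Option Turing.Dir → Tape a → Tape a
  | none, T => T
  | some Turing.Dir.left, T => ⟨T.left.tail, T.left.headD none :: T.right⟩
  | some Turing.Dir.right, T => ⟨T.right.headD none :: T.left, T.right.tail⟩

/-- The longest prefix of a list of symbols that consists of bits. -/
def bitPrefix : List (Sym a) → List Bool
  | some (Sum.inl b) :: l => b :: bitPrefix l
  | _ => []

/-- Replace the query word, which is the longest block of bits that starts at the scanned cell and
extends to the right, by the answer of the oracle `O`. -/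
def ask (O : List Bool → List Bool) (T : Tape a) : Tape a :=
  ⟨T.left, (O (bitPrefix T.right)).map Sym.bit ++ T.right.drop (bitPrefix T.right).length⟩

end Tape

/-- A deterministic multi-tape oracle Turing machine. Tapes `0`, `1`, `2` initially hold the three
components of the input, tape `3` is the query tape, and there are `numWork` further work tapes. -/
structure OracleTM where
  numStates : ℕ
  numWork : ℕ
  numExtra : ℕ
  start : Fin numStates
  accept : Fin numStates
  reject : Fin numStates
  query : Fin numStates
  resume : Fin numStates
  trans : Fin numStates → (Fin (numWork + 4) → Sym numExtra) →
    Fin numStates × (Fin (numWork + 4) → Sym numExtra × Option Turing.Dir)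

namespace OracleTM

/-- A configuration: a state and the contents and head positions of all tapes. -/
structure Cfg (M : OracleTM) where
  state : Fin M.numStates
  tapes : Fin (M.numWork + 4) → Tape M.numExtra

/-- The initial configuration on input `(x, y, z)`. -/
def initCfg (M : OracleTM) (x y z : List Bool) : M.Cfg where
  state := M.start
  tapes i :=
    if i = 0 then Tape.init x else if i = 1 then Tape.init y
    else if i = 2 then Tape.init z else Tape.init []

/-- One step with oracle `O`. The accepting and the rejecting state halt. In the query state, the
query word is replaced by the oracle's answer, as a single step. -/
def step (M : OracleTM) (O : List Bool → List Bool) (c : M.Cfg) : M.Cfg :=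
  if c.state = M.accept ∨ c.state = M.reject then c
  else if c.state = M.query then
    ⟨M.resume, Function.update c.tapes 3 ((c.tapes 3).ask O)⟩
  else
    let act := M.trans c.state (fun i => (c.tapes i).read)
    ⟨act.1, fun i => Tape.move (act.2 i).2 (Tape.write (act.2 i).1 (c.tapes i))⟩

/-- The output of `M` with oracle `O` on input `(x, y, z)` if `M` halts within `t` steps (`true` for
acceptance, `false` for rejection), and `none` if it does not. -/
def output (M : OracleTM) (O : List Bool → List Bool) (t : ℕ) (x y z : List Bool) : Option Bool :=
  let c := (M.step O)^[t] (M.initCfg x y z)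
  if c.state = M.accept then some true else if c.state = M.reject then some false else none

end OracleTM

/-! ### The class MA relative to a group oracle -/

/-- The predicate `R` is computable in polynomial time (in the length of the input) by a
deterministic Turing machine with access to the group oracle `B`. -/
def PolyTime (B : GroupOracle) (R : List Bool → List Bool → List Bool → Bool) : Prop :=
  ∃ (M : OracleTM) (t : ℕ[X]), ∀ x y z : List Bool,
    M.output B.answer (t.eval (x.length + y.length + z.length)) x y z = some (R x y z)

/-- The number of `z ∈ Σʳ` with `R x y z = 1`. -/
def acceptCount (R : List Bool → List Bool → List Bool → Bool) (x y : List Bool) (r : ℕ) : ℕ :=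
  Fintype.card {z : Str r // R x y z.toList = true}

/-- The class `MA^B`. The length `q` of the certificates is a polynomial other than the zero
polynomial (for which the two conditions below would define `co-NP^B`). -/
def MA (B : GroupOracle) : Set (Language Bool) :=
  {A | ∃ (R : List Bool → List Bool → List Bool → Bool) (q r : ℕ[X]), PolyTime B R ∧ q ≠ 0 ∧
    ∀ x : List Bool,
      (x ∈ A → ∃ y : Str (q.eval x.length),
        acceptCount R x y.toList (r.eval x.length) = 2 ^ r.eval x.length) ∧
      (x ∉ A → ∀ y : Str (q.eval x.length),
        (acceptCount R x y.toList (r.eval x.length) : ℝ) <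
          ((2 : ℝ) ^ (2 * q.eval x.length))⁻¹ * 2 ^ r.eval x.length)}

end BlackBox

/-! ### Counting bijections that satisfy few linear equations -/

namespace BlackBox

/-! All gates used to defeat a verifier come from the group `Vec (k + 1)`, encoded by a bijection
`ψ` from strings to vectors. Fix strings `a i` encoding the first `k` unit vectors and one further
string `b`. The instance is positive if `ψ b` is the last unit vector `v₀` (bijections `P`) and
negative if the last coordinate `χ` vanishes at `ψ b` (bijections `Q`).

For fixed certificate and random string, the answers in a run amount to at most `T` equations `ψ z =
ψ x + ψ y`. Solutions of such a system with `ψ b = v₀` can be shifted along `χ` so that `b` takes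
any value in `ker χ`. There are thus at least `|ker χ|` times as many solutions mapping `b` into the
kernel, and at least half that many remain after discarding non-injective ones
(`card_injective_solutions_le`). Summing over transcripts gives `card_accepted_le`: a run accepts at
least half as large a share of `Q` as of `P`, in the sense that `N * |P ∩ acc| ≤ 2 * |Q ∩ acc|`
while `|Q| ≤ N * |P|`, with `N = 2 ^ k`.

Averaging over certificates and random strings refutes the verifier (`false_of_card_accepted_le`).
Each element of `P` has a certificate accepted by every random string, whereas the error bound
`|Y|⁻²`, summed over all `|Y| ≥ 2` certificates, leaves at most half of that for an element of `Q`.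
A finite-extension argument (`exists_forall_of_forall_extension`) treats the countably many
verifiers one after another. -/

open scoped Classical in
/-- The number of bijections that extend a partial injection depends only on its domain. -/
lemma card_extensions_eq {X V : Type*} [Fintype X] [Fintype V] (S : Finset X) {σ σ' : X → V}
    (hσ : Set.InjOn σ S) (hσ' : Set.InjOn σ' S) :
    Fintype.card {ψ : X ≃ V // ∀ x ∈ S, ψ x = σ x} =
      Fintype.card {ψ : X ≃ V // ∀ x ∈ S, ψ x = σ' x} := by
  -- The partial matching `σ x ↦ σ' x` extends to a permutation of `V`; composing with it exchanges
  -- the two sets of extensions.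
  let e : {v // v ∈ σ '' S} ≃ {v // v ∈ σ' '' S} :=
    (Equiv.Set.imageOfInjOn σ S hσ).symm.trans (Equiv.Set.imageOfInjOn σ' S hσ')
  let π : Equiv.Perm V := e.extendSubtype
  have hπ : ∀ x ∈ S, π (σ x) = σ' x := by
    intro x hx
    have hm : σ x ∈ σ '' S := ⟨x, hx, rfl⟩
    have h1 : π (σ x) = e ⟨σ x, hm⟩ := e.extendSubtype_apply_of_mem _ hm
    have h2 : (⟨σ x, hm⟩ : {v // v ∈ σ '' S}) = Equiv.Set.imageOfInjOn σ S hσ ⟨x, hx⟩ := rfl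
    rw [h1, h2]
    simp only [e, Equiv.trans_apply, Equiv.symm_apply_apply]
    rfl
  refine Fintype.card_congr
    ⟨fun ψ => ⟨ψ.1.trans π, fun x hx => by simp [ψ.2 x hx, hπ x hx]⟩,
     fun ψ => ⟨ψ.1.trans π.symm, fun x hx => by simp [ψ.2 x hx, ← hπ x hx]⟩, ?_, ?_⟩
  · intro ψ; ext; simp
  · intro ψ; ext; simp

/-- `S` collects every place on which an instance and a transcript depend: one per generator, one
for `b`, three per equation. -/
lemma exists_support {X ι : Type*} [Fintype ι] (a : ι → X) (b : X) (τ : Finset (X × X × X)) :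
    ∃ S : Finset X, (∀ i, a i ∈ S) ∧ b ∈ S ∧ (∀ p ∈ τ, p.1 ∈ S ∧ p.2.1 ∈ S ∧ p.2.2 ∈ S) ∧
      S.card ≤ Fintype.card ι + 1 + 3 * τ.card := by
  classical
  refine ⟨insert b (Finset.univ.image a) ∪ (τ.image (fun p => p.1) ∪
    (τ.image (fun p => p.2.1) ∪ τ.image (fun p => p.2.2))), fun i => ?_, ?_, fun p hp => ?_, ?_⟩
  · exact Finset.mem_union_left _
      (Finset.mem_insert_of_mem (Finset.mem_image_of_mem a (Finset.mem_univ i)))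
  · exact Finset.mem_union_left _ (Finset.mem_insert_self _ _)
  · exact ⟨Finset.mem_union_right _ (Finset.mem_union_left _ (Finset.mem_image.2 ⟨p, hp, rfl⟩)),
      Finset.mem_union_right _ (Finset.mem_union_right _
        (Finset.mem_union_left _ (Finset.mem_image.2 ⟨p, hp, rfl⟩))),
      Finset.mem_union_right _ (Finset.mem_union_right _
        (Finset.mem_union_right _ (Finset.mem_image.2 ⟨p, hp, rfl⟩)))⟩
  · have h1 : (insert b (Finset.univ.image a)).card ≤ Fintype.card ι + 1 :=
      (Finset.card_insert_le _ _).trans (Nat.add_le_add_right Finset.card_image_le 1)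
    have h2 : ∀ g : X × X × X → X, (τ.image g).card ≤ τ.card := fun g => Finset.card_image_le
    refine ((Finset.card_union_le _ _).trans (Nat.add_le_add h1 ((Finset.card_union_le _ _).trans
      (Nat.add_le_add (h2 _) ((Finset.card_union_le _ _).trans
        (Nat.add_le_add (h2 _) (h2 _))))))).trans (le_of_eq ?_)
    ring

section Combinatorics

variable {K V X ι : Type*} [Field K] [AddCommGroup V] [Module K V]

/-- `σ` satisfies all the equations `σ z = σ x + σ y` with `(x, y, z) ∈ τ`. -/
def Consistent (τ : Finset (X × X × X)) (σ : X → V) : Prop :=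
  ∀ p ∈ τ, σ p.2.2 = σ p.1 + σ p.2.1

/-- The solutions, supported on `S`, of the equations `τ` with prescribed values `e i` at `a i`. -/
def IsSol (S : Finset X) (τ : Finset (X × X × X)) (a : ι → X) (e : ι → V) (σ : X → V) : Prop :=
  (∀ x ∉ S, σ x = 0) ∧ Consistent τ σ ∧ ∀ i, σ (a i) = e i

/-- This is the basic shift. The scalar function `χ ∘ μ` satisfies the same additive equations and
vanishes at all `a i`, so any vector multiple of it can be added. -/
lemma IsSol.add_smul {S : Finset X} {τ : Finset (X × X × X)} {a : ι → X} {e e' : ι → V}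
    {σ μ : X → V} (hσ : IsSol S τ a e σ) (hμ : IsSol S τ a e' μ) (χ : V →ₗ[K] K)
    (hχ : ∀ i, χ (e' i) = 0) (v : V) : IsSol S τ a e (fun x => σ x + χ (μ x) • v) := by
  refine ⟨fun x hx => by simp [hσ.1 x hx, hμ.1 x hx], fun p hp => ?_, fun i => ?_⟩
  · simp only [hσ.2.1 p hp, hμ.2.1 p hp, map_add]; module
  · simp [hσ.2.2 i, hμ.2.2 i, hχ i]

lemma IsSol.sub {S : Finset X} {τ : Finset (X × X × X)} {a : ι → X} {e e' : ι → V}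
    {σ μ : X → V} (hσ : IsSol S τ a e σ) (hμ : IsSol S τ a e' μ) :
    IsSol S τ a (fun i => e i - e' i) (fun x => σ x - μ x) := by
  refine ⟨fun x hx => by simp [hσ.1 x hx, hμ.1 x hx], fun p hp => ?_, fun i => ?_⟩
  · simp only [hσ.2.1 p hp, hμ.2.1 p hp]; abel
  · simp [hσ.2.2 i, hμ.2.2 i]

variable [Fintype X] [Fintype V]

open scoped Classical in
/-- Solutions that identify two given places are at most as many as the solutions with value `v₀`
at `b`, if one of the latter separates the two places. -/
lemma card_collision_le {S : Finset X} {τ : Finset (X × X × X)} {a : ι → X} {e : ι → V}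
    {b : X} {v₀ : V} {χ : V →ₗ[K] K} (he : ∀ i, χ (e i) = 0) (hv₀ : χ v₀ = 1) {ψ₀ : X → V}
    (hψ₀ : IsSol S τ a e ψ₀) (hb : ψ₀ b = v₀) {x x' : X} (hx : ψ₀ x ≠ ψ₀ x') :
    (Finset.univ.filter fun σ : X → V =>
        (IsSol S τ a e σ ∧ χ (σ b) = 0) ∧ σ x = σ x').card ≤
      (Finset.univ.filter fun σ : X → V => IsSol S τ a e σ ∧ σ b = v₀).card := by
  rcases Finset.eq_empty_or_nonempty (Finset.univ.filter fun σ : X → V =>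
        (IsSol S τ a e σ ∧ χ (σ b) = 0) ∧ σ x = σ x') with h | ⟨σ₁, hσ₁⟩
  · rw [h]; simp
  simp only [Finset.mem_filter, Finset.mem_univ, true_and] at hσ₁
  obtain ⟨⟨hσ₁, hσ₁b⟩, hσ₁x⟩ := hσ₁
  obtain ⟨ρ, hρ, hρb, hρx⟩ : ∃ ρ, IsSol S τ a e ρ ∧ ρ b = v₀ ∧ χ (ρ x - ρ x') ≠ 0 := by
    -- If `χ` misses the difference, shift `σ₁` to `h1`, which has value `v₀` at `b` and still
    -- identifies `x` and `x'`. Then `ψ₀ - h1` vanishes at `b` and at all `a i`, and separates `x`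
    -- from `x'`; a functional `η` detecting this, multiplied by `v₀`, makes the separation visible
    -- to `χ`.
    by_cases hw : χ (ψ₀ x - ψ₀ x') = 0
    · have h1 := hσ₁.add_smul hψ₀ χ he (v₀ - σ₁ b)
      have h2 := hψ₀.sub h1
      obtain ⟨η, hη⟩ : ∃ η : V →ₗ[K] K, η (ψ₀ x - ψ₀ x') ≠ 0 := by
        by_contra! hcon
        exact hx (sub_eq_zero.1 ((Module.forall_dual_apply_eq_zero_iff K _).1 hcon))
      refine ⟨_, hψ₀.add_smul h2 η (by simp) v₀, by simp [hb, hv₀], ?_⟩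
      have h3 : χ (ψ₀ x) = χ (ψ₀ x') := by rwa [map_sub, sub_eq_zero] at hw
      have h4 : η (ψ₀ x) - η (ψ₀ x') ≠ 0 := by rwa [map_sub] at hη
      simp only [map_sub, map_add, map_smul, smul_eq_mul, hv₀, h3, hσ₁x]
      intro h; apply h4; linear_combination h
    · exact ⟨ψ₀, hψ₀, hb, hw⟩
  -- The shift moves the value at `b` to `v₀`. It is invertible on colliding solutions, because the
  -- new values at `x` and `x'` differ by a known nonzero multiple of `v₀ - σ b`.
  refine Finset.card_le_card_of_injOn (fun σ y => σ y + χ (ρ y) • (v₀ - σ b)) ?_ ?_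
  · intro σ hσ
    simp only [Finset.coe_filter, Finset.mem_univ, true_and, Set.mem_ofPred_eq] at hσ ⊢
    exact ⟨hσ.1.1.add_smul hρ χ he _, by simp [hρb, hv₀]⟩
  · intro σ hσ σ' hσ' h
    simp only [Finset.coe_filter, Finset.mem_univ, true_and, Set.mem_ofPred_eq] at hσ hσ'
    have key : σ b = σ' b := by
      have hd : ∀ σ : X → V, σ x = σ x' → (σ x + χ (ρ x) • (v₀ - σ b)) -
          (σ x' + χ (ρ x') • (v₀ - σ b)) = χ (ρ x - ρ x') • (v₀ - σ b) := by
        intro σ hs; rw [hs, map_sub, sub_smul]; abel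
      have h1 := hd σ hσ.2
      have h2 := hd σ' hσ'.2
      have hx1 := congrFun h x
      have hx2 := congrFun h x'
      simp only at hx1 hx2
      rw [hx1, hx2, h2] at h1
      have := smul_right_injective V hρx h1
      simpa using this.symm
    funext y
    have hy := congrFun h y
    simp only [key] at hy
    exact add_right_cancel hy

-- Shifting along `χ ∘ ψ₀` replaces the value `v₀` at `b` by any `u` in the kernel; `u` is read off
-- at `b`, and then `σ` is recovered.
open scoped Classical in
lemma card_mul_card_le {S : Finset X} {τ : Finset (X × X × X)} {a : ι → X} {e : ι → V}
    {b : X} {v₀ : V} {χ : V →ₗ[K] K} (he : ∀ i, χ (e i) = 0) (hv₀ : χ v₀ = 1) {ψ₀ : X → V}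
    (hψ₀ : IsSol S τ a e ψ₀) (hb : ψ₀ b = v₀) :
    Fintype.card {v : V // χ v = 0} *
        (Finset.univ.filter fun σ : X → V => IsSol S τ a e σ ∧ σ b = v₀).card ≤
      (Finset.univ.filter fun σ : X → V => IsSol S τ a e σ ∧ χ (σ b) = 0).card := by
  rw [← Finset.card_univ, ← Finset.card_product]
  refine Finset.card_le_card_of_injOn
    (fun q y => q.2 y + χ (ψ₀ y) • ((q.1 : V) - v₀)) ?_ ?_
  · rintro ⟨u, σ⟩ hσ
    simp only [Finset.coe_product, Set.mem_prod, Finset.coe_filter, Finset.mem_univ, true_and,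
      Set.mem_ofPred_eq] at hσ ⊢
    exact ⟨hσ.2.1.add_smul hψ₀ χ he _, by simp [hσ.2.2, hb, hv₀, u.2]⟩
  · rintro ⟨u, σ⟩ hσ ⟨u', σ'⟩ hσ' h
    simp only [Finset.coe_product, Set.mem_prod, Finset.coe_filter, Finset.mem_univ, true_and,
      Set.mem_ofPred_eq] at hσ hσ'
    have hbb := congrFun h b
    simp only [hσ.2.2, hσ'.2.2, hb, hv₀, one_smul, add_sub_cancel] at hbb
    have hu : u = u' := Subtype.ext hbb
    subst hu
    have : σ = σ' := by
      funext y
      exact add_right_cancel (congrFun h y)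
    rw [this]

open scoped Classical in
/-- Injective solutions with `σ b ∈ ker χ` are almost `|ker χ|` times as many as those with
`σ b = v₀`. -/
lemma card_injective_solutions_le {S : Finset X} (τ : Finset (X × X × X)) {a : ι → X} {e : ι → V}
    {b : X} {v₀ : V} {χ : V →ₗ[K] K} (he : ∀ i, χ (e i) = 0) (hv₀ : χ v₀ = 1)
    (hS : 2 * S.card ^ 2 ≤ Fintype.card {v : V // χ v = 0}) :
    Fintype.card {v : V // χ v = 0} *
        (Finset.univ.filter fun σ : X → V =>
          (IsSol S τ a e σ ∧ σ b = v₀) ∧ Set.InjOn σ S).card ≤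
      2 * (Finset.univ.filter fun σ : X → V =>
          (IsSol S τ a e σ ∧ χ (σ b) = 0) ∧ Set.InjOn σ S).card := by
  rcases Finset.eq_empty_or_nonempty (Finset.univ.filter fun σ : X → V =>
          (IsSol S τ a e σ ∧ σ b = v₀) ∧ Set.InjOn σ S) with h | ⟨ψ₀, hψ₀⟩
  · rw [h]; simp
  simp only [Finset.mem_filter, Finset.mem_univ, true_and] at hψ₀
  obtain ⟨⟨hψ₀, hb⟩, hinj⟩ := hψ₀
  set N := Fintype.card {v : V // χ v = 0}
  set p := (Finset.univ.filter fun σ : X → V => IsSol S τ a e σ ∧ σ b = v₀).card with hp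
  have h1 : (Finset.univ.filter fun σ : X → V =>
      (IsSol S τ a e σ ∧ σ b = v₀) ∧ Set.InjOn σ S).card ≤ p :=
    Finset.card_le_card fun σ hσ => by
      simp only [Finset.mem_filter, Finset.mem_univ, true_and] at hσ ⊢
      exact hσ.1
  have h2 := card_mul_card_le he hv₀ hψ₀ hb
  -- Union bound over pairs of places in `S`: each pair accounts for at most `p` non-injective
  -- solutions. With `2 * |S|² ≤ N`, these are at most half of `N * p`.
  have h3 : (Finset.univ.filter fun σ : X → V => IsSol S τ a e σ ∧ χ (σ b) = 0) ⊆
      (Finset.univ.filter fun σ : X → V =>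
          (IsSol S τ a e σ ∧ χ (σ b) = 0) ∧ Set.InjOn σ S) ∪
        S.offDiag.biUnion fun q => Finset.univ.filter fun σ : X → V =>
          (IsSol S τ a e σ ∧ χ (σ b) = 0) ∧ σ q.1 = σ q.2 := by
    intro σ hσ
    simp only [Finset.mem_filter, Finset.mem_univ, true_and, Finset.mem_union,
      Finset.mem_biUnion, Finset.mem_offDiag] at hσ ⊢
    by_cases hi : Set.InjOn σ S
    · exact Or.inl ⟨hσ, hi⟩
    · right
      simp only [Set.InjOn, not_forall] at hi
      obtain ⟨x, hx, x', hx', hxx, hne⟩ := hi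
      exact ⟨(x, x'), ⟨hx, hx', hne⟩, hσ, hxx⟩
  have h4 := (Finset.card_le_card h3).trans (Finset.card_union_le _ _)
  have h5 : (S.offDiag.biUnion fun q => Finset.univ.filter fun σ : X → V =>
          (IsSol S τ a e σ ∧ χ (σ b) = 0) ∧ σ q.1 = σ q.2).card ≤ S.offDiag.card * p := by
    refine Finset.card_biUnion_le_card_mul _ _ _ fun q hq => ?_
    rw [Finset.mem_offDiag] at hq
    exact card_collision_le he hv₀ hψ₀ hb fun h => hq.2.2 (hinj hq.1 hq.2.1 h)
  have h6 : S.offDiag.card ≤ S.card ^ 2 := by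
    rw [Finset.offDiag_card, sq]; exact Nat.sub_le _ _
  have h7 : S.offDiag.card * p ≤ S.card ^ 2 * p := Nat.mul_le_mul_right _ h6
  have h8 : 2 * S.card ^ 2 * p ≤ N * p := Nat.mul_le_mul_right _ hS
  have h9 := Nat.mul_le_mul_left N h1
  nlinarith

-- For a condition that depends only on the values on `S`, bijections are counted by their
-- restrictions to `S`, represented as functions vanishing off `S`. Every injective restriction has
-- equally many extensions.
open scoped Classical in
lemma card_equiv_eq_mul (S : Finset X) (A : (X → V) → Prop)
    (hA : ∀ σ σ' : X → V, (∀ x ∈ S, σ x = σ' x) → A σ → A σ') {σ₀ : X → V}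
    (hσ₀ : Set.InjOn σ₀ S) :
    (Finset.univ.filter fun ψ : X ≃ V => A ψ).card =
      (Finset.univ.filter fun σ : X → V => ((∀ x ∉ S, σ x = 0) ∧ A σ) ∧ Set.InjOn σ S).card *
        Fintype.card {ψ : X ≃ V // ∀ x ∈ S, ψ x = σ₀ x} := by
  rw [Finset.card_eq_sum_card_fiberwise (f := fun (ψ : X ≃ V) (x : X) => if x ∈ S then ψ x else 0)
    (t := Finset.univ.filter fun σ : X → V => ((∀ x ∉ S, σ x = 0) ∧ A σ) ∧ Set.InjOn σ S)]
  · refine Finset.sum_const_nat fun σ hσ => ?_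
    simp only [Finset.mem_filter, Finset.mem_univ, true_and] at hσ
    rw [card_extensions_eq S hσ₀ hσ.2, Fintype.card_subtype, Finset.filter_filter]
    congr 1
    ext ψ
    simp only [Finset.mem_filter, Finset.mem_univ, true_and]
    constructor
    · rintro ⟨-, h⟩ x hx
      rw [← h]; simp [hx]
    · intro h
      refine ⟨hA _ _ (fun x hx => (h x hx).symm) hσ.1.2, ?_⟩
      funext x
      by_cases hx : x ∈ S
      · simp [hx, h x hx]
      · simp [hx, hσ.1.1 x hx]
  · intro ψ hψ
    simp only [Finset.coe_filter, Finset.mem_univ, true_and, Set.mem_ofPred_eq] at hψ ⊢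
    refine ⟨⟨fun x hx => by simp [hx], hA _ _ (fun x hx => by simp [hx]) hψ⟩, ?_⟩
    intro x hx y hy h
    have hx' : x ∈ S := hx
    have hy' : y ∈ S := hy
    simpa [hx', hy'] using h

open scoped Classical in
/-- The bijections that satisfy the equations `τ` and map `b` into `ker χ` are almost `|ker χ|`
times as many as those that map `b` to `v₀`. -/
lemma card_consistent_le [Fintype ι] {S : Finset X} {τ : Finset (X × X × X)} {a : ι → X} {e : ι → V}
    {b : X} {v₀ : V} {χ : V →ₗ[K] K} (he : ∀ i, χ (e i) = 0) (hv₀ : χ v₀ = 1)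
    (ha : ∀ i, a i ∈ S) (hb : b ∈ S) (hτ : ∀ p ∈ τ, p.1 ∈ S ∧ p.2.1 ∈ S ∧ p.2.2 ∈ S)
    (hS : 2 * S.card ^ 2 ≤ Fintype.card {v : V // χ v = 0}) :
    Fintype.card {v : V // χ v = 0} * (Finset.univ.filter fun ψ : X ≃ V =>
          (Consistent τ ψ ∧ ∀ i, ψ (a i) = e i) ∧ ψ b = v₀).card ≤
      2 * (Finset.univ.filter fun ψ : X ≃ V =>
          (Consistent τ ψ ∧ ∀ i, ψ (a i) = e i) ∧ χ (ψ b) = 0).card := by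
  rcases Finset.eq_empty_or_nonempty (Finset.univ.filter fun ψ : X ≃ V =>
          (Consistent τ ψ ∧ ∀ i, ψ (a i) = e i) ∧ ψ b = v₀) with h | ⟨ψ₀, -⟩
  · rw [h]; simp
  have hloc : ∀ (D : V → Prop) (σ σ' : X → V), (∀ x ∈ S, σ x = σ' x) →
      ((Consistent τ σ ∧ ∀ i, σ (a i) = e i) ∧ D (σ b)) →
      ((Consistent τ σ' ∧ ∀ i, σ' (a i) = e i) ∧ D (σ' b)) := by
    rintro D σ σ' h ⟨⟨h1, h2⟩, h3⟩
    refine ⟨⟨fun p hp => ?_, fun i => by rw [← h _ (ha i), h2 i]⟩, by rwa [← h _ hb]⟩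
    rw [← h _ (hτ p hp).1, ← h _ (hτ p hp).2.1, ← h _ (hτ p hp).2.2, h1 p hp]
  have hi : Set.InjOn (ψ₀ : X → V) S := ψ₀.injective.injOn
  have hP := card_equiv_eq_mul S (fun σ => (Consistent τ σ ∧ ∀ i, σ (a i) = e i) ∧ σ b = v₀)
    (hloc (fun v => v = v₀)) hi
  have hN := card_equiv_eq_mul S
    (fun σ => (Consistent τ σ ∧ ∀ i, σ (a i) = e i) ∧ χ (σ b) = 0) (hloc (fun v => χ v = 0)) hi
  have key := card_injective_solutions_le (S := S) τ (a := a) (b := b) he hv₀ hS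
  simp only [IsSol, and_assoc] at key hP hN ⊢
  rw [hP, hN, ← mul_assoc, ← mul_assoc]
  exact Nat.mul_le_mul_right _ key

open scoped Classical in
/-- The bijections that map `b` into `ker χ` are at most `|ker χ|` times as many as those that map
`b` to `v₀`. -/
lemma card_ker_le {a : ι → X} {e : ι → V} {b : X} {v₀ : V} {χ : V →ₗ[K] K} [Finite ι]
    {ψ₀ : X ≃ V} (hψ₀ : ∀ i, ψ₀ (a i) = e i) (hb : ψ₀ b = v₀) (P Q : Finset (X ≃ V))
    (hP : ∀ ψ, ψ ∈ P ↔ (∀ i, ψ (a i) = e i) ∧ ψ b = v₀)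
    (hQ : ∀ ψ, ψ ∈ Q ↔ (∀ i, ψ (a i) = e i) ∧ χ (ψ b) = 0) :
    Q.card ≤ Nat.card {v : V // χ v = 0} * P.card := by
  have := Fintype.ofFinite ι
  obtain rfl : P = Finset.univ.filter fun ψ : X ≃ V => (∀ i, ψ (a i) = e i) ∧ ψ b = v₀ := by
    ext ψ; simp [hP]
  obtain rfl : Q = Finset.univ.filter fun ψ : X ≃ V => (∀ i, ψ (a i) = e i) ∧ χ (ψ b) = 0 := by
    ext ψ; simp [hQ]
  rw [mul_comm, Nat.card_eq_fintype_card, Fintype.card_subtype]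
  refine Finset.card_le_mul_card_image_of_maps_to (f := fun ψ : X ≃ V => ψ b)
    (fun ψ hψ => ?_) _ fun v _ => ?_
  · simp only [Finset.mem_filter, Finset.mem_univ, true_and] at hψ ⊢
    exact hψ.2
  rcases Finset.eq_empty_or_nonempty (Finset.filter (fun ψ : X ≃ V => ψ b = v)
    (Finset.univ.filter fun ψ : X ≃ V => (∀ i, ψ (a i) = e i) ∧ χ (ψ b) = 0)) with h | ⟨ψ₁, hψ₁⟩
  · rw [h]; simp
  simp only [Finset.mem_filter, Finset.mem_univ, true_and] at hψ₁
  -- The bijections with given values at all `a i` and at `b` are equally many whichever attained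
  -- value `v` is prescribed at `b`.
  have h := card_extensions_eq (insert b (Finset.univ.image a)) (σ := ψ₁) (σ' := ψ₀)
    ψ₁.injective.injOn ψ₀.injective.injOn
  rw [Fintype.card_subtype, Fintype.card_subtype] at h
  refine le_trans (Finset.card_le_card fun ψ hψ => ?_)
    (h.le.trans (Finset.card_le_card fun ψ hψ => ?_))
  · simp only [Finset.mem_filter, Finset.mem_univ, true_and] at hψ
    simp [hψ.2, hψ.1.1, hψ₁.1.1, hψ₁.2]
  · simp only [Finset.mem_filter, Finset.mem_univ, true_and, Finset.mem_insert, Finset.mem_image,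
      forall_eq_or_imp, forall_exists_index, forall_apply_eq_imp_iff] at hψ ⊢
    exact ⟨fun i => by rw [hψ.2 i, hψ₀ i], by rw [hψ.1, hb]⟩

open scoped Classical in
/-- An algorithm that makes few queries accepts at least half as large a share of the bijections
that map `b` into `ker χ` as of those that map `b` to `v₀`. The set `key ψ` records the queries and
the answers of the run with `ψ`. -/
theorem card_accepted_le {a : ι → X} {e : ι → V} {b : X} {v₀ : V} {χ : V →ₗ[K] K} [Fintype ι]
    (he : ∀ i, χ (e i) = 0) (hv₀ : χ v₀ = 1) (acc : (X ≃ V) → Prop)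
    (key : (X ≃ V) → Finset (X × X × X)) {T : ℕ} (hT : ∀ ψ, (key ψ).card ≤ T)
    (hself : ∀ ψ, Consistent (key ψ) ψ)
    (hdet : ∀ ψ ψ' : X ≃ V, Consistent (key ψ) ψ' → key ψ' = key ψ ∧ (acc ψ' ↔ acc ψ))
    {N : ℕ} (hN : Nat.card {v : V // χ v = 0} = N)
    (hcard : 2 * (Fintype.card ι + 1 + 3 * T) ^ 2 ≤ N) (P Q : Finset (X ≃ V))
    (hP : ∀ ψ, ψ ∈ P ↔ (∀ i, ψ (a i) = e i) ∧ ψ b = v₀)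
    (hQ : ∀ ψ, ψ ∈ Q ↔ (∀ i, ψ (a i) = e i) ∧ χ (ψ b) = 0) :
    N * (P.filter acc).card ≤ 2 * (Q.filter acc).card := by
  subst hN
  obtain rfl : P = Finset.univ.filter fun ψ : X ≃ V => (∀ i, ψ (a i) = e i) ∧ ψ b = v₀ := by
    ext ψ; simp [hP]
  obtain rfl : Q = Finset.univ.filter fun ψ : X ≃ V => (∀ i, ψ (a i) = e i) ∧ χ (ψ b) = 0 := by
    ext ψ; simp [hQ]
  rw [Nat.card_eq_fintype_card] at hcard ⊢
  rw [Finset.filter_filter, Finset.filter_filter]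
  rw [Finset.card_eq_sum_card_fiberwise (f := key) (t := Finset.univ) (by simp [Set.MapsTo]),
    Finset.card_eq_sum_card_fiberwise (f := key) (t := Finset.univ) (by simp [Set.MapsTo]),
    Finset.mul_sum, Finset.mul_sum]
  refine Finset.sum_le_sum fun τ _ => ?_
  by_cases hτ : ∃ ψ, acc ψ ∧ key ψ = τ
  · obtain ⟨ψ₁, hacc, rfl⟩ := hτ
    -- A transcript determines the run, so an accepted fibre of `key` is exactly the solution set of
    -- its equations.
    have hchar : ∀ ψ : X ≃ V, (acc ψ ∧ key ψ = key ψ₁) ↔ Consistent (key ψ₁) ψ := by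
      intro ψ
      constructor
      · rintro ⟨-, h⟩; rw [← h]; exact hself ψ
      · intro h
        obtain ⟨h1, h2⟩ := hdet _ _ h
        exact ⟨h2.2 hacc, h1⟩
    have hre : ∀ D : (X ≃ V) → Prop, Finset.filter (fun ψ => key ψ = key ψ₁)
        (Finset.univ.filter fun ψ : X ≃ V => ((∀ i, ψ (a i) = e i) ∧ D ψ) ∧ acc ψ) =
        Finset.univ.filter fun ψ : X ≃ V =>
          (Consistent (key ψ₁) ψ ∧ ∀ i, ψ (a i) = e i) ∧ D ψ := by
      intro D
      ext ψ
      simp only [Finset.mem_filter, Finset.mem_univ, true_and, ← hchar]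
      tauto
    rw [hre fun ψ => ψ b = v₀, hre fun ψ => χ (ψ b) = 0]
    obtain ⟨S, ha, hb, hp, hSc⟩ := exists_support a b (key ψ₁)
    have hSc' : S.card ≤ Fintype.card ι + 1 + 3 * T :=
      hSc.trans (Nat.add_le_add_left (Nat.mul_le_mul_left 3 (hT ψ₁)) _)
    exact card_consistent_le he hv₀ ha hb hp
      ((Nat.mul_le_mul_left 2 (Nat.pow_le_pow_left hSc' 2)).trans hcard)
  · have : Finset.filter (fun ψ => key ψ = τ) (Finset.univ.filter fun ψ : X ≃ V =>
          ((∀ i, ψ (a i) = e i) ∧ ψ b = v₀) ∧ acc ψ) = ∅ := by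
      refine Finset.filter_eq_empty_iff.2 fun ψ hψ h => hτ ⟨ψ, ?_, h⟩
      simp only [Finset.mem_filter] at hψ
      exact hψ.2.2
    rw [this]; simp

end Combinatorics

/-! ### Gates of elementary abelian 2-groups -/

lemma quad_inj {n : ℕ} {c b c' b' : Bool} {x y x' y' : Str n} (h : quad c b x y = quad c' b' x' y') :
    c = c' ∧ b = b' ∧ x = x' ∧ y = y' := by
  have h' := congrArg List.Vector.toList h
  simp only [quad, List.Vector.toList_mk, List.cons.injEq] at h'
  obtain ⟨hc, hb, h'⟩ := h'
  obtain ⟨hx, hy⟩ := List.append_inj h' (by simp)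
  exact ⟨hc, hb, List.Vector.toList_injective hx, List.Vector.toList_injective hy⟩

/-- Strings of length `2n + 2` correspond to quadruples. -/
noncomputable def quadEquiv (n : ℕ) : (Bool × Bool × Str n × Str n) ≃ Str (2 * n + 2) :=
  Equiv.ofBijective (fun p => quad p.1 p.2.1 p.2.2.1 p.2.2.2) <| by
    rw [Fintype.bijective_iff_injective_and_card]
    constructor
    · rintro ⟨c, b, x, y⟩ ⟨c', b', x', y'⟩ h
      obtain ⟨rfl, rfl, rfl, rfl⟩ := quad_inj h
      rfl
    · simp only [Fintype.card_prod, Fintype.card_bool, card_vector]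
      ring

@[simp] lemma quadEquiv_symm_quad {n : ℕ} (c b : Bool) (x y : Str n) :
    (quadEquiv n).symm (quad c b x y) = (c, b, x, y) :=
  (quadEquiv n).symm_apply_apply (c, b, x, y)

lemma exists_quad {n : ℕ} (w : Str (2 * n + 2)) : ∃ c b x y, w = quad c b x y :=
  ⟨_, _, _, _, ((quadEquiv n).apply_symm_apply w).symm⟩

/-- The elementary abelian group of order `2ⁿ`. -/
abbrev Vec (n : ℕ) : Type := Fin n → ZMod 2

lemma Vec.add_self {n : ℕ} (v : Vec n) : v + v = 0 := by
  funext i; exact CharTwo.add_self_eq_zero (v i)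

/-- The multiplication gate of `Vec n` with the encoding `ψ⁻¹`. -/
noncomputable def mulGate {n : ℕ} (ψ : Str n ≃ Vec n) : Equiv.Perm (Str (2 * n + 2)) :=
  Function.Involutive.toPerm (fun w =>
    quad ((quadEquiv n).symm w).1 ((quadEquiv n).symm w).2.1 ((quadEquiv n).symm w).2.2.1
      (ψ.symm (ψ ((quadEquiv n).symm w).2.2.1 + ψ ((quadEquiv n).symm w).2.2.2))) <| by
    intro w
    obtain ⟨c, b, x, y, rfl⟩ := exists_quad w
    simp [← add_assoc, Vec.add_self]

lemma mulGate_quad {n : ℕ} (ψ : Str n ≃ Vec n) (c b : Bool) (x y : Str n) :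
    mulGate ψ (quad c b x y) = quad c b x (ψ.symm (ψ x + ψ y)) :=
  (congrFun (Function.Involutive.coe_toPerm _) _).trans (by simp)

/-- Every string encodes an element, so the error bit never changes; every element is its own
inverse, so both control bits act alike. -/
lemma realizes_mulGate {n : ℕ} (ψ : Str n ≃ Vec n) :
    Realizes (mulGate ψ) (fun g : Multiplicative (Vec n) => ψ.symm g.toAdd) := by
  refine ⟨fun g h hgh => by simpa using hgh, fun c b g h => ?_, fun c b x y hxy => ?_⟩
  · have hinv : -g.toAdd = g.toAdd := neg_eq_of_add_eq_zero_left (Vec.add_self _)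
    rw [mulGate_quad]
    cases c <;> simp [add_comm, hinv]
  · have hs : ∀ x : Str n, x ∈ Set.range (fun g : Multiplicative (Vec n) => ψ.symm g.toAdd) :=
      fun x => ⟨Multiplicative.ofAdd (ψ x), by simp⟩
    simp [hs] at hxy

lemma exists_equiv_vec (n : ℕ) : Nonempty (Str n ≃ Vec n) :=
  ⟨Fintype.equivOfCardEq (by simp [card_vector, ZMod.card])⟩

instance : Nonempty GroupOracle :=
  ⟨⟨fun n => mulGate (exists_equiv_vec n).some, fun _ => ⟨_, _, _, realizes_mulGate _⟩⟩⟩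

/-- Replace the gate for strings of length `n`. -/
noncomputable def GroupOracle.update (B : GroupOracle) (n : ℕ) (ψ : Str n ≃ Vec n) :
    GroupOracle where
  gate := Function.update B.gate n (mulGate ψ)
  exists_group m := by
    by_cases h : m = n
    · subst h
      rw [Function.update_self]
      exact ⟨_, _, _, realizes_mulGate ψ⟩
    · rw [Function.update_of_ne h]
      exact B.exists_group m

@[simp] lemma GroupOracle.update_gate_self (B : GroupOracle) (n : ℕ) (ψ : Str n ≃ Vec n) :
    (B.update n ψ).gate n = mulGate ψ := Function.update_self ..

lemma GroupOracle.update_gate_of_ne (B : GroupOracle) {n m : ℕ} (ψ : Str n ≃ Vec n) (h : m ≠ n) :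
    (B.update n ψ).gate m = B.gate m := Function.update_of_ne h ..

lemma GroupOracle.answer_congr {B B' : GroupOracle} {w : List Bool}
    (h : B.gate ((w.length - 2) / 2) = B'.gate ((w.length - 2) / 2)) :
    B.answer w = B'.answer w := by
  simp only [GroupOracle.answer, h]

lemma GroupOracle.answer_toList (B : GroupOracle) {n : ℕ} (v : Str (2 * n + 2)) :
    B.answer v.toList = (B.gate n v).toList := by
  obtain ⟨l, hl⟩ := v
  have e : n = (l.length - 2) / 2 := by omega
  subst e
  exact dif_pos hl

/-! ### Instances of group non-membership -/

/-- Non-membership does not depend on the group chosen to realize the gate: any such group embeds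
into `Vec n` by `g ↦ ψ (f g)`, and injective homomorphisms preserve and reflect membership in
generated subgroups. -/
lemma nonMember_iff {B : GroupOracle} {n : ℕ} {ψ : Str n ≃ Vec n} (hB : B.gate n = mulGate ψ)
    (gs : List (Str n)) (h : Str n) :
    B.NonMember n gs h ↔ Multiplicative.ofAdd (ψ h) ∉
      Subgroup.closure {u : Multiplicative (Vec n) | u ∈ gs.map fun x => .ofAdd (ψ x)} := by
  constructor
  · rintro ⟨G, _, f, ⟨hinj, hmul, -⟩, us, v, rfl, rfl, hv⟩ hmem
    let φ : G →* Multiplicative (Vec n) := MonoidHom.mk' (fun g => .ofAdd (ψ (f g))) <| by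
      intro g g'
      have h1 := hmul false false g' g
      rw [hB, mulGate_quad] at h1
      have h2 := (quad_inj h1).2.2.2
      rw [Equiv.symm_apply_eq] at h2
      simp only [Bool.false_eq_true, if_false] at h2
      rw [← h2, add_comm, ofAdd_add]
    have hφ : Function.Injective φ := fun g g' hgg => hinj (ψ.injective hgg)
    have hset : {u : Multiplicative (Vec n) | u ∈ (us.map f).map fun x => .ofAdd (ψ x)} =
        φ '' {u : G | u ∈ us} := by
      ext u
      simp only [List.mem_map, Set.mem_ofPred_eq, Set.mem_image]
      constructor
      · rintro ⟨_, ⟨g, hg, rfl⟩, rfl⟩; exact ⟨g, hg, rfl⟩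
      · rintro ⟨g, hg, rfl⟩; exact ⟨_, ⟨g, hg, rfl⟩, rfl⟩
    rw [hset, ← MonoidHom.map_closure] at hmem
    obtain ⟨v', hv', he⟩ := hmem
    exact hv (hφ he ▸ hv')
  · intro hmem
    refine ⟨Multiplicative (Vec n), inferInstance, fun g => ψ.symm g.toAdd,
      by rw [hB]; exact realizes_mulGate ψ, gs.map fun x => .ofAdd (ψ x), .ofAdd (ψ h), ?_, ?_,
      hmem⟩
    · simp [Function.comp_def]
    · simp

lemma replicate_append_inj {k k' : ℕ} {l l' : List Bool}
    (h : List.replicate k true ++ false :: l = List.replicate k' true ++ false :: l') :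
    k = k' ∧ l = l' := by
  induction k generalizing k' with
  | zero => cases k' <;> simp_all [List.replicate_succ]
  | succ k ih =>
    cases k' with
    | zero => simp [List.replicate_succ] at h
    | succ k' =>
      simp only [List.replicate_succ, List.cons_append, List.cons.injEq, true_and] at h
      simpa using ih h

lemma flatten_append_inj {n : ℕ} {gs gs' : List (Str n)} {h h' : Str n}
    (hl : gs.length = gs'.length) (he : (gs.map List.Vector.toList).flatten ++ h.toList =
      (gs'.map List.Vector.toList).flatten ++ h'.toList) : gs = gs' ∧ h = h' := by
  induction gs generalizing gs' with
  | nil =>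
    cases gs' with
    | nil => exact ⟨rfl, List.Vector.toList_injective (by simpa using he)⟩
    | cons _ _ => simp at hl
  | cons g gs ih =>
    cases gs' with
    | nil => simp at hl
    | cons g' gs' =>
      simp only [List.map_cons, List.flatten_cons, List.append_assoc] at he
      obtain ⟨h1, h2⟩ := List.append_inj he (by simp)
      obtain ⟨rfl, rfl⟩ := ih (by simpa using hl) h2
      rw [List.Vector.toList_injective h1]
      exact ⟨rfl, rfl⟩

lemma encodeInstance_mem_GNM {B : GroupOracle} {n : ℕ} {gs : List (Str n)} {h : Str n} :
    encodeInstance gs h ∈ GNM B ↔ B.NonMember n gs h := by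
  constructor
  · rintro ⟨n', gs', h', hm, he⟩
    obtain ⟨hk, he⟩ := replicate_append_inj he
    obtain ⟨rfl, he⟩ := replicate_append_inj he
    obtain ⟨rfl, rfl⟩ := flatten_append_inj hk he
    exact hm
  · exact fun hm => ⟨n, gs, h, hm, rfl⟩

lemma length_encodeInstance {n : ℕ} (gs : List (Str n)) (h : Str n) :
    (encodeInstance gs h).length = gs.length + 1 + (n + 1 + (gs.length * n + n)) := by
  simp only [encodeInstance, List.length_append, List.length_replicate, List.length_cons,
    List.length_flatten, List.map_map, List.Vector.toList_length, Function.comp_def,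
    List.map_const', List.sum_replicate, smul_eq_mul]
  ring

lemma ofAdd_mem_closure_single {k : ℕ} {v : Vec (k + 1)} (hv : v (Fin.last k) = 0) :
    Multiplicative.ofAdd v ∈ Subgroup.closure
      (Set.range fun i : Fin k => Multiplicative.ofAdd (Pi.single i.castSucc 1 : Vec (k + 1))) := by
  have : v = ∑ i : Fin (k + 1), Pi.single i (v i) := by
    funext j; rw [Finset.sum_apply]; simp
  rw [this, ofAdd_sum]
  refine Subgroup.prod_mem _ fun i _ => ?_
  refine Fin.lastCases ?_ (fun i => ?_) i
  · rw [hv, Pi.single_zero]; exact Subgroup.one_mem _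
  · rcases (by decide : ∀ c : ZMod 2, c = 0 ∨ c = 1) (v i.castSucc) with h | h <;> rw [h]
    · rw [Pi.single_zero]; exact Subgroup.one_mem _
    · exact Subgroup.subset_closure ⟨i, rfl⟩

/-- The first `k` unit vectors generate the kernel of the last coordinate, which is itself a
homomorphism. -/
lemma nonMember_ofFn_iff {B : GroupOracle} {k : ℕ} {ψ : Str (k + 1) ≃ Vec (k + 1)}
    (hB : B.gate (k + 1) = mulGate ψ) {a : Fin k → Str (k + 1)} {b : Str (k + 1)}
    (ha : ∀ i, ψ (a i) = Pi.single i.castSucc 1) :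
    B.NonMember (k + 1) (List.ofFn a) b ↔ ψ b (Fin.last k) ≠ 0 := by
  have hset : {u : Multiplicative (Vec (k + 1)) |
      u ∈ (List.ofFn a).map fun x => .ofAdd (ψ x)} =
      Set.range fun i : Fin k => Multiplicative.ofAdd (Pi.single i.castSucc 1 : Vec (k + 1)) := by
    ext u
    simp [List.mem_ofFn, ha]
  rw [nonMember_iff hB, hset, not_iff_not]
  refine ⟨fun h => ?_, ofAdd_mem_closure_single⟩
  let χ : Multiplicative (Vec (k + 1)) →* Multiplicative (ZMod 2) :=
    (Pi.evalAddMonoidHom (fun _ => ZMod 2) (Fin.last k)).toMultiplicative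
  have hle : Subgroup.closure (Set.range fun i : Fin k =>
      Multiplicative.ofAdd (Pi.single i.castSucc 1 : Vec (k + 1))) ≤ χ.ker := by
    rw [Subgroup.closure_le]
    rintro _ ⟨i, rfl⟩
    have : (Pi.single i.castSucc 1 : Vec (k + 1)) (Fin.last k) = 0 :=
      Pi.single_eq_of_ne (Fin.castSucc_lt_last i).ne' _
    exact congrArg Multiplicative.ofAdd this
  exact congrArg Multiplicative.toAdd (MonoidHom.mem_ker.1 (hle h))

/-! ### Oracle machines -/

namespace OracleTM

/-- The word on the query tape at time `i`. -/
def queryWord (M : OracleTM) (O : List Bool → List Bool) (x y z : List Bool) (i : ℕ) : List Bool :=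
  Tape.bitPrefix (((M.step O)^[i] (M.initCfg x y z)).tapes 3).right

/-- Agreement is required only along the run with `O`. The word on the query tape counts at every
time, whether or not it is being asked. -/
lemma iterate_step_congr {M : OracleTM} {O O' : List Bool → List Bool} {x y z : List Bool} {T : ℕ}
    (h : ∀ i < T, O (M.queryWord O x y z i) = O' (M.queryWord O x y z i)) :
    ∀ i ≤ T, (M.step O)^[i] (M.initCfg x y z) = (M.step O')^[i] (M.initCfg x y z) := by
  intro i
  induction i with
  | zero => intro _; rfl
  | succ i ih =>
    intro hi
    rw [Function.iterate_succ_apply', Function.iterate_succ_apply', ← ih (by omega)]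
    have hw := h i (by omega)
    unfold queryWord at hw
    simp only [step, Tape.ask, hw]

lemma output_congr {M : OracleTM} {O O' : List Bool → List Bool} {x y z : List Bool} {T : ℕ}
    (h : ∀ i < T, O (M.queryWord O x y z i) = O' (M.queryWord O x y z i)) :
    M.output O T x y z = M.output O' T x y z := by
  simp only [output, iterate_step_congr h T le_rfl]

instance : Countable OracleTM := by
  have : Finite Turing.Dir := Finite.of_injective (β := Bool)
    (fun d => match d with | .left => true | .right => false) (by
      intro a b; cases a <;> cases b <;> simp)
  let F : OracleTM → Σ p : ℕ × ℕ × ℕ, (Fin p.1 × Fin p.1 × Fin p.1 × Fin p.1 × Fin p.1) ×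
      ((Fin p.1 → (Fin (p.2.1 + 4) → Sym p.2.2) →
        Fin p.1 × (Fin (p.2.1 + 4) → Sym p.2.2 × Option Turing.Dir))) :=
    fun M => ⟨(M.numStates, M.numWork, M.numExtra),
      (M.start, M.accept, M.reject, M.query, M.resume), M.trans⟩
  have : ∀ p : ℕ × ℕ × ℕ, Finite ((Fin p.1 × Fin p.1 × Fin p.1 × Fin p.1 × Fin p.1) ×
      ((Fin p.1 → (Fin (p.2.1 + 4) → Sym p.2.2) →
        Fin p.1 × (Fin (p.2.1 + 4) → Sym p.2.2 × Option Turing.Dir)))) := by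
    intro p
    have h1 : Finite (Sym p.2.2) := inferInstanceAs (Finite (Option _))
    have h2 : Finite (Sym p.2.2 × Option Turing.Dir) := inferInstance
    have h3 : Finite (Fin (p.2.1 + 4) → Sym p.2.2 × Option Turing.Dir) := inferInstance
    have h4 : Finite (Fin (p.2.1 + 4) → Sym p.2.2) := inferInstance
    infer_instance
  refine Function.Injective.countable (f := F) ?_
  rintro ⟨s, w, e, _, _, _, _, _, _⟩ ⟨s', w', e', _, _, _, _, _, _⟩ h
  simp only [F, Sigma.mk.injEq, Prod.mk.injEq] at h
  obtain ⟨⟨rfl, rfl, rfl⟩, h⟩ := h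
  simp only [heq_eq_eq, Prod.mk.injEq] at h
  obtain ⟨⟨rfl, rfl, rfl, rfl, rfl⟩, rfl⟩ := h
  rfl

end OracleTM

/-- The two strings to be multiplied by a query `w` to the gate for strings of length `n`. -/
noncomputable def operands (n : ℕ) (w : List Bool) : Str n × Str n :=
  if h : w.length = 2 * n + 2 then ((quadEquiv n).symm ⟨w, h⟩).2.2
  else (List.Vector.replicate n false, List.Vector.replicate n false)

lemma operands_quad {n : ℕ} (c b : Bool) (x y : Str n) :
    operands n (quad c b x y).toList = (x, y) := by
  rw [operands, dif_pos (List.Vector.toList_length _)]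
  exact congrArg (fun p => p.2.2) (quadEquiv_symm_quad c b x y)

lemma answer_update_congr (B : GroupOracle) {n : ℕ} {ψ ψ' : Str n ≃ Vec n} {w : List Bool}
    (h : ψ.symm (ψ (operands n w).1 + ψ (operands n w).2) =
      ψ'.symm (ψ' (operands n w).1 + ψ' (operands n w).2)) :
    (B.update n ψ).answer w = (B.update n ψ').answer w := by
  by_cases hw : w.length = 2 * n + 2
  · obtain ⟨c, b, x, y, hq⟩ := exists_quad (⟨w, hw⟩ : Str (2 * n + 2))
    have hw' : w = (quad c b x y).toList := congrArg List.Vector.toList hq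
    subst hw'
    rw [operands_quad] at h
    rw [GroupOracle.answer_toList, GroupOracle.answer_toList, GroupOracle.update_gate_self,
      GroupOracle.update_gate_self, mulGate_quad, mulGate_quad, h]
  -- The rounded index can equal `n` for other lengths, such as `2 * n + 3`; such words are returned
  -- unchanged.
  · by_cases hn : (w.length - 2) / 2 = n
    · have hw' : ¬ w.length = 2 * ((w.length - 2) / 2) + 2 := by rwa [hn]
      rw [GroupOracle.answer, GroupOracle.answer, dif_neg hw', dif_neg hw']
    · refine GroupOracle.answer_congr ?_
      rw [GroupOracle.update_gate_of_ne _ _ hn, GroupOracle.update_gate_of_ne _ _ hn]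

/-- The last coordinate. -/
def lastCoord (k : ℕ) : Vec (k + 1) →ₗ[ZMod 2] ZMod 2 := LinearMap.proj (Fin.last k)

lemma lastCoord_apply {k : ℕ} (v : Vec (k + 1)) : lastCoord k v = v (Fin.last k) := rfl

lemma card_lastCoord_eq_zero (k : ℕ) :
    Nat.card {v : Vec (k + 1) // lastCoord k v = 0} = 2 ^ k := by
  let e : {v : Vec (k + 1) // lastCoord k v = 0} ≃ Vec k :=
    ⟨fun v i => v.1 i.castSucc, fun u => ⟨Fin.snoc u 0, by simp [lastCoord_apply]⟩, fun v => by
      have hv : v.1 (Fin.last k) = 0 := v.2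
      ext i
      refine Fin.lastCases ?_ (fun i => ?_) i
      · simp [hv]
      · simp, fun u => by ext i; simp⟩
  rw [Nat.card_congr e]
  simp [ZMod.card]

open scoped Classical in
/-- An oracle machine accepts at least half as large a share of the encodings that map `b` into the
kernel of `lastCoord k` as of those that map `b` to a fixed element outside. -/
lemma card_output_le (B : GroupOracle) (M : OracleTM) (x y z : List Bool) {k T : ℕ}
    (a : Fin k → Str (k + 1)) (b : Str (k + 1)) (hT : 2 * (k + 1 + 3 * T) ^ 2 ≤ 2 ^ k)
    (P Q : Finset (Str (k + 1) ≃ Vec (k + 1)))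
    (hP : ∀ ψ, ψ ∈ P ↔ (∀ i, ψ (a i) = Pi.single i.castSucc 1) ∧ ψ b = Pi.single (Fin.last k) 1)
    (hQ : ∀ ψ, ψ ∈ Q ↔ (∀ i, ψ (a i) = Pi.single i.castSucc 1) ∧ lastCoord k (ψ b) = 0)
    (acc : (Str (k + 1) ≃ Vec (k + 1)) → Prop)
    (hacc : ∀ ψ, acc ψ ↔ M.output (B.update (k + 1) ψ).answer T x y z = some true) :
    2 ^ k * (P.filter acc).card ≤ 2 * (Q.filter acc).card := by
  let q : (Str (k + 1) ≃ Vec (k + 1)) → ℕ → Str (k + 1) × Str (k + 1) := fun ψ i =>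
    operands (k + 1) (M.queryWord (B.update (k + 1) ψ).answer x y z i)
  -- One equation per time step. Words of another length contribute their default operands, a
  -- superfluous equation that still holds for `ψ` and fits the bound `T`.
  let key : (Str (k + 1) ≃ Vec (k + 1)) → Finset (Str (k + 1) × Str (k + 1) × Str (k + 1)) :=
    fun ψ => (Finset.range T).image fun i =>
      ((q ψ i).1, (q ψ i).2, ψ.symm (ψ (q ψ i).1 + ψ (q ψ i).2))
  refine card_accepted_le (χ := lastCoord k)
    (fun i => Pi.single_eq_of_ne (Fin.castSucc_lt_last i).ne' _) (by simp [lastCoord_apply])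
    acc key (T := T) (fun ψ => Finset.card_image_le.trans (Finset.card_range T).le) ?_ ?_
    (card_lastCoord_eq_zero k) (by rwa [Fintype.card_fin]) P Q hP hQ
  · intro ψ p hp
    obtain ⟨i, -, rfl⟩ := Finset.mem_image.1 hp
    simp
  · intro ψ ψ' hc
    have hop : ∀ i < T, ψ.symm (ψ (q ψ i).1 + ψ (q ψ i).2) =
        ψ'.symm (ψ' (q ψ i).1 + ψ' (q ψ i).2) := by
      intro i hi
      have := hc _ (Finset.mem_image_of_mem _ (Finset.mem_range.2 hi))
      rw [← this, Equiv.symm_apply_apply]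
    have hans : ∀ i < T, (B.update (k + 1) ψ).answer
          (M.queryWord (B.update (k + 1) ψ).answer x y z i) =
        (B.update (k + 1) ψ').answer (M.queryWord (B.update (k + 1) ψ).answer x y z i) :=
      fun i hi => answer_update_congr B (hop i hi)
    have hqe : ∀ i < T, q ψ' i = q ψ i := by
      intro i hi
      simp only [q, OracleTM.queryWord, OracleTM.iterate_step_congr hans i hi.le]
    refine ⟨Finset.image_congr fun i hi => ?_, by rw [hacc, hacc, OracleTM.output_congr hans]⟩
    have hi' : i < T := Finset.mem_range.1 hi
    simp only [hqe i hi', hop i hi']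

/-! ### Counting certificates -/

open scoped Classical in
/-- If, for all `y` and `z`, the share of accepted elements of `Q` is at least half the share of
accepted elements of `P`, then no certificate system `acc` accepts the elements of `P` and rejects
those of `Q` with the error bound `|Y|⁻²`. -/
lemma false_of_card_accepted_le {Ψ Y Z : Type*} [Fintype Y] [Fintype Z] {P Q : Finset Ψ}
    (acc : Y → Z → Ψ → Prop) {u : ℕ} (hu : 0 < u)
    (h : ∀ y z, u * (P.filter (acc y z)).card ≤ 2 * (Q.filter (acc y z)).card)
    (hQP : Q.card ≤ u * P.card) (hP : P.Nonempty) (hZ : 0 < Fintype.card Z)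
    (hY : 2 ≤ Fintype.card Y) (hpos : ∀ ψ ∈ P, ∃ y, ∀ z, acc y z ψ)
    (hneg : ∀ ψ ∈ Q, ∀ y, Fintype.card Y ^ 2 * (Finset.univ.filter fun z => acc y z ψ).card <
      Fintype.card Z) : False := by
  have hswap : ∀ D : Finset Ψ, ∑ y, ∑ z, (D.filter (acc y z)).card =
      ∑ ψ ∈ D, ∑ y, (Finset.univ.filter fun z => acc y z ψ).card := by
    intro D
    simp only [Finset.card_filter]
    rw [Finset.sum_comm (s := D)]
    refine Finset.sum_congr rfl fun y _ => ?_
    rw [Finset.sum_comm]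
  have h1 : u * ∑ ψ ∈ P, ∑ y, (Finset.univ.filter fun z => acc y z ψ).card ≤
      2 * ∑ ψ ∈ Q, ∑ y, (Finset.univ.filter fun z => acc y z ψ).card := by
    rw [← hswap, ← hswap]
    simp only [Finset.mul_sum]
    exact Finset.sum_le_sum fun y _ => Finset.sum_le_sum fun z _ => h y z
  have h2 : P.card * Fintype.card Z ≤
      ∑ ψ ∈ P, ∑ y, (Finset.univ.filter fun z => acc y z ψ).card := by
    rw [← smul_eq_mul]
    refine Finset.card_nsmul_le_sum _ _ _ fun ψ hψ => ?_
    obtain ⟨y, hy⟩ := hpos ψ hψ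
    refine le_trans ?_ (Finset.single_le_sum (f := fun y =>
      (Finset.univ.filter fun z => acc y z ψ).card) (fun _ _ => Nat.zero_le _) (Finset.mem_univ y))
    simp [hy]
  have h3 : ∀ ψ ∈ Q, Fintype.card Y * ∑ y, (Finset.univ.filter fun z => acc y z ψ).card <
      Fintype.card Z := by
    intro ψ hψ
    have : Nonempty Y := Fintype.card_pos_iff.1 (by omega)
    have h4 : ∑ y : Y, Fintype.card Y ^ 2 * (Finset.univ.filter fun z => acc y z ψ).card <
        ∑ _y : Y, Fintype.card Z :=
      Finset.sum_lt_sum_of_nonempty Finset.univ_nonempty fun y _ => hneg ψ hψ y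
    rw [← Finset.mul_sum, Finset.sum_const, Finset.card_univ, smul_eq_mul, sq, mul_assoc] at h4
    exact lt_of_mul_lt_mul_left h4 (Nat.zero_le _)
  have h5 : 0 < u * (P.card * Fintype.card Z) :=
    Nat.mul_pos hu (Nat.mul_pos hP.card_pos hZ)
  have h6 := Nat.mul_le_mul_left u h2
  -- The strict inequality summed over `Q` needs `Q` nonempty; for empty `Q` the bound `h1` already
  -- contradicts `h5` and `h6`.
  rcases Q.eq_empty_or_nonempty with rfl | hQ
  · simp only [Finset.sum_empty] at h1
    omega
  have h7 := Finset.sum_lt_sum_of_nonempty hQ h3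
  rw [← Finset.mul_sum, Finset.sum_const, smul_eq_mul] at h7
  have h8 := Nat.mul_le_mul_right (∑ ψ ∈ Q, ∑ y, (Finset.univ.filter fun z => acc y z ψ).card) hY
  have h9 := Nat.mul_le_mul_right (Fintype.card Z) hQP
  rw [mul_assoc] at h9
  omega

/-- The factor `C` is kept general because the induction step for sums uses `2 * C` for each
summand. -/
lemma eventually_mul_eval_le_two_pow (p : ℕ[X]) (C : ℕ) :
    ∀ᶠ k in Filter.atTop, C * p.eval k ≤ 2 ^ k := by
  induction p using Polynomial.induction_on' generalizing C with
  | add p q hp hq =>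
    filter_upwards [hp (2 * C), hq (2 * C)] with k h1 h2
    rw [eval_add]
    nlinarith
  | monomial d c =>
    have h := tendsto_pow_const_div_const_pow_of_one_lt d (r := 2) one_lt_two
    have hlt := (h.const_mul ((C : ℝ) * c)).eventually_lt_const (u := 1) (by simp)
    filter_upwards [hlt] with k hk
    rw [eval_monomial]
    have h2 : (0 : ℝ) < 2 ^ k := by positivity
    rw [← mul_div_assoc, div_lt_one h2] at hk
    have : (C : ℝ) * (c * k ^ d) ≤ 2 ^ k := by linarith
    exact_mod_cast this

/-! ### Diagonalization -/

/-- The machine `M` decides in time `t` a predicate that proves the language `A` to be in `MA^B`,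
with certificates of length `q` and random strings of length `r`. -/
def Verifies (B : GroupOracle) (A : Language Bool) (M : OracleTM) (t q r : ℕ[X]) : Prop :=
  ∃ R : List Bool → List Bool → List Bool → Bool,
    (∀ x y z : List Bool,
      M.output B.answer (t.eval (x.length + y.length + z.length)) x y z = some (R x y z)) ∧
    ∀ x : List Bool,
      (x ∈ A → ∃ y : Str (q.eval x.length),
        acceptCount R x y.toList (r.eval x.length) = 2 ^ r.eval x.length) ∧
      (x ∉ A → ∀ y : Str (q.eval x.length),
        (acceptCount R x y.toList (r.eval x.length) : ℝ) <
          ((2 : ℝ) ^ (2 * q.eval x.length))⁻¹ * 2 ^ r.eval x.length)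

-- Acceptance conditions guaranteed for `B'` are transferred to `B` when both answer alike every
-- query word in the relevant runs. The error bound becomes an inequality between natural numbers.
open scoped Classical in
lemma Verifies.output_iff {B B' : GroupOracle} {A : Language Bool} {M : OracleTM} {t q r : ℕ[X]}
    (hV : Verifies B' A M t q r) (x : List Bool) {T : ℕ}
    (hT : T = t.eval (x.length + q.eval x.length + r.eval x.length))
    (hB : ∀ (y : Str (q.eval x.length)) (z : Str (r.eval x.length)), ∀ i < T,
      B.answer (M.queryWord B.answer x y.toList z.toList i) =
        B'.answer (M.queryWord B.answer x y.toList z.toList i)) :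
    (x ∈ A → ∃ y : Str (q.eval x.length), ∀ z : Str (r.eval x.length),
      M.output B.answer T x y.toList z.toList = some true) ∧
    (x ∉ A → ∀ y : Str (q.eval x.length), Fintype.card (Str (q.eval x.length)) ^ 2 *
      (Finset.univ.filter fun z : Str (r.eval x.length) =>
        M.output B.answer T x y.toList z.toList = some true).card <
          Fintype.card (Str (r.eval x.length))) := by
  obtain ⟨R, hR, hA⟩ := hV
  have hout : ∀ (y : Str (q.eval x.length)) (z : Str (r.eval x.length)),
      M.output B.answer T x y.toList z.toList = some true ↔ R x y.toList z.toList = true := by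
    intro y z
    have h := hR x y.toList z.toList
    rw [List.Vector.toList_length, List.Vector.toList_length, ← hT] at h
    rw [OracleTM.output_congr (hB y z), h, Option.some_inj]
  simp only [hout]
  have hcount : ∀ y : Str (q.eval x.length), acceptCount R x y.toList (r.eval x.length) =
      (Finset.univ.filter fun z : Str (r.eval x.length) => R x y.toList z.toList = true).card :=
    fun y => Fintype.card_subtype _
  refine ⟨fun hx => ?_, fun hx y => ?_⟩
  · obtain ⟨y, hy⟩ := (hA x).1 hx
    refine ⟨y, fun z => ?_⟩
    rw [hcount] at hy
    have huniv := Finset.eq_univ_of_card _ (hy.trans (by simp [card_vector]))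
    have := Finset.mem_univ z
    rw [← huniv] at this
    exact (Finset.mem_filter.1 this).2
  · have h := (hA x).2 hx y
    rw [← div_eq_inv_mul, lt_div_iff₀ (by positivity), hcount] at h
    rw [card_vector, card_vector, Fintype.card_bool, ← pow_mul, mul_comm, mul_comm _ 2]
    exact_mod_cast h

/-- A bound for the lengths of the strings in all queries of finitely many runs. -/
lemma exists_query_bound (M : OracleTM) (O : List Bool → List Bool) (x : List Bool) (T q r : ℕ) :
    ∃ m, ∀ (y : Str q) (z : Str r), ∀ i < T,
      ((M.queryWord O x y.toList z.toList i).length - 2) / 2 < m := by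
  let f : Str q × Str r × Fin T → ℕ := fun p =>
    ((M.queryWord O x p.1.toList p.2.1.toList p.2.2).length - 2) / 2
  exact ⟨Finset.univ.sup f + 1, fun y z i hi =>
    Nat.lt_succ_of_le (Finset.le_sup (f := f) (Finset.mem_univ (y, z, ⟨i, hi⟩)))⟩

/-- `L` is the length of the encoded instance with `k` generators of length `k + 1`; the support
bound stays polynomial in `k` while the kernel has `2 ^ k` elements. -/
lemma exists_large (t q r : ℕ[X]) (m : ℕ) : ∃ k ≥ m, ∀ L,
    L = k + 1 + (k + 1 + 1 + (k * (k + 1) + (k + 1))) →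
      2 * (k + 1 + 3 * t.eval (L + q.eval L + r.eval L)) ^ 2 ≤ 2 ^ k := by
  let ℓ : ℕ[X] := X + 1 + (X + 1 + 1 + (X * (X + 1) + (X + 1)))
  let p : ℕ[X] := (X + 1 + 3 * t.comp (ℓ + q.comp ℓ + r.comp ℓ)) ^ 2
  obtain ⟨k, hk, hm⟩ := ((eventually_mul_eval_le_two_pow p 2).and
    (Filter.eventually_ge_atTop m)).exists
  refine ⟨k, hm, ?_⟩
  rintro L rfl
  simpa [p, ℓ, eval_comp] using hk

/-- One stage of the diagonalization: the gates for strings of length at least `m` can be chosen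
such that finitely many of them prevent a given machine from proving `GNM` to be in `MA`. -/
theorem exists_not_verifies (B : GroupOracle) (m : ℕ) (M : OracleTM) (t q r : ℕ[X]) (hq : q ≠ 0) :
    ∃ (B' : GroupOracle) (m' : ℕ), m < m' ∧ (∀ j < m, B'.gate j = B.gate j) ∧
      ∀ B'' : GroupOracle, (∀ j < m', B''.gate j = B'.gate j) →
        ¬ Verifies B'' (GNM B'') M t q r := by
  classical
  by_contra! hcon
  obtain ⟨k, hkm, hk⟩ := exists_large t q r m
  obtain ⟨ψ₀⟩ := exists_equiv_vec (k + 1)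
  let a : Fin k → Str (k + 1) := fun i => ψ₀.symm (Pi.single i.castSucc 1)
  let b : Str (k + 1) := ψ₀.symm (Pi.single (Fin.last k) 1)
  obtain ⟨x, hx⟩ : ∃ x, x = encodeInstance (List.ofFn a) b := ⟨_, rfl⟩
  have hlen : x.length = k + 1 + (k + 1 + 1 + (k * (k + 1) + (k + 1))) := by
    rw [hx, length_encodeInstance, List.length_ofFn]
  obtain ⟨T, hT⟩ : ∃ T, T = t.eval (x.length + q.eval x.length + r.eval x.length) := ⟨_, rfl⟩
  have hkT : 2 * (k + 1 + 3 * T) ^ 2 ≤ 2 ^ k := hT ▸ hk _ hlen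
  -- This is where `q ≠ 0` enters: it yields at least two certificates, hence the factor that beats
  -- the loss of one half.
  have hq1 : 1 ≤ q.eval x.length := by
    refine Nat.one_le_iff_ne_zero.2 fun h0 => hq ?_
    ext i
    rw [eval_eq_sum_range, Finset.sum_eq_zero_iff] at h0
    by_cases hi : i ∈ Finset.range (q.natDegree + 1)
    · have hpos : 0 < x.length := by omega
      simpa [hpos.ne'] using h0 i hi
    · rw [coeff_eq_zero_of_natDegree_lt (by simpa using hi), coeff_zero]
  -- The verified extension `B''` may vary with `ψ`, but it agrees with `B.update (k + 1) ψ` beyond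
  -- the reach of all relevant queries. All acceptance conditions can therefore be stated for the
  -- updated oracles, which differ only in one gate.
  have hmain : ∀ ψ : Str (k + 1) ≃ Vec (k + 1), (∀ i, ψ (a i) = Pi.single i.castSucc 1) →
      (ψ b (Fin.last k) ≠ 0 → ∃ y : Str (q.eval x.length), ∀ z : Str (r.eval x.length),
        M.output (B.update (k + 1) ψ).answer T x y.toList z.toList = some true) ∧
      (¬ ψ b (Fin.last k) ≠ 0 → ∀ y : Str (q.eval x.length),
        Fintype.card (Str (q.eval x.length)) ^ 2 *
        (Finset.univ.filter fun z : Str (r.eval x.length) =>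
          M.output (B.update (k + 1) ψ).answer T x y.toList z.toList = some true).card <
            Fintype.card (Str (r.eval x.length))) := by
    intro ψ ha
    obtain ⟨m₁, hm₁⟩ := exists_query_bound M (B.update (k + 1) ψ).answer x T
      (q.eval x.length) (r.eval x.length)
    obtain ⟨B'', hB'', hV⟩ := hcon (B.update (k + 1) ψ) (max m₁ (k + 2))
      (lt_of_lt_of_le (by omega) (le_max_right _ _))
      (fun j hj => B.update_gate_of_ne ψ (by omega))
    have hgate : B''.gate (k + 1) = mulGate ψ := by
      rw [hB'' (k + 1) (lt_of_lt_of_le (by omega) (le_max_right _ _)),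
        GroupOracle.update_gate_self]
    have hmem : x ∈ GNM B'' ↔ ψ b (Fin.last k) ≠ 0 := by
      rw [hx, encodeInstance_mem_GNM, nonMember_ofFn_iff hgate ha]
    rw [← hmem]
    exact hV.output_iff x hT fun y z i hi => GroupOracle.answer_congr
      (hB'' _ (lt_of_lt_of_le (hm₁ y z i hi) (le_max_left _ _))).symm
  let P : Finset (Str (k + 1) ≃ Vec (k + 1)) := Finset.univ.filter fun ψ =>
    (∀ i, ψ (a i) = Pi.single i.castSucc 1) ∧ ψ b = Pi.single (Fin.last k) 1
  let Q : Finset (Str (k + 1) ≃ Vec (k + 1)) := Finset.univ.filter fun ψ =>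
    (∀ i, ψ (a i) = Pi.single i.castSucc 1) ∧ lastCoord k (ψ b) = 0
  have hP : ∀ ψ, ψ ∈ P ↔
      (∀ i, ψ (a i) = Pi.single i.castSucc 1) ∧ ψ b = Pi.single (Fin.last k) 1 := by simp [P]
  have hQ : ∀ ψ, ψ ∈ Q ↔
      (∀ i, ψ (a i) = Pi.single i.castSucc 1) ∧ lastCoord k (ψ b) = 0 := by simp [Q]
  have hψ₀ : ∀ i, ψ₀ (a i) = Pi.single i.castSucc 1 := fun i => ψ₀.apply_symm_apply _
  have hb : ψ₀ b = Pi.single (Fin.last k) 1 := ψ₀.apply_symm_apply _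
  refine false_of_card_accepted_le (P := P) (Q := Q) (u := 2 ^ k)
    (fun (y : Str (q.eval x.length)) (z : Str (r.eval x.length)) ψ =>
      M.output (B.update (k + 1) ψ).answer T x y.toList z.toList = some true) (by positivity)
    (fun y z => ?_) ?_ ⟨ψ₀, (hP _).2 ⟨hψ₀, hb⟩⟩ (by simp [card_vector]) ?_
    (fun ψ hψ => ?_) (fun ψ hψ y => ?_)
  · convert card_output_le B M x y.toList z.toList a b hkT P Q hP hQ _ fun ψ => Iff.rfl
  · rw [← card_lastCoord_eq_zero k]
    exact card_ker_le hψ₀ hb P Q hP hQ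
  · rw [card_vector, Fintype.card_bool]
    exact Nat.le_self_pow (by omega) 2
  · rw [hP] at hψ
    exact (hmain ψ hψ.1).1 (by rw [hψ.2]; simp)
  · rw [hQ] at hψ
    convert (hmain ψ hψ.1).2 (not_not.2 hψ.2) y

lemma countable_polynomial_nat : Countable ℕ[X] :=
  Function.Injective.countable (f := fun p : ℕ[X] => p.toFinsupp.coeff) fun _ _ h =>
    Polynomial.toFinsupp_injective (by ext; simp_all)

/-- Countably many requirements, each of which can be met by a finite extension of any finite
condition, are met by a common oracle. -/
lemma exists_forall_of_forall_extension {E : Type*} [Countable E] (Bad : E → GroupOracle → Prop)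
    (h : ∀ (e : E) (B : GroupOracle) (m : ℕ), ∃ (B' : GroupOracle) (m' : ℕ), m < m' ∧
      (∀ j < m, B'.gate j = B.gate j) ∧
      ∀ B'' : GroupOracle, (∀ j < m', B''.gate j = B'.gate j) → ¬ Bad e B'') :
    ∃ B : GroupOracle, ∀ e, ¬ Bad e B := by
  rcases isEmpty_or_nonempty E with hE | hE
  · exact ⟨Classical.arbitrary _, fun e => hE.elim e⟩
  obtain ⟨enum, henum⟩ := exists_surjective_nat E
  choose next bound hlt hagree hbad using h
  let s : ℕ → GroupOracle × ℕ := fun i => Nat.rec (Classical.arbitrary GroupOracle, 0)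
    (fun i p => (next (enum i) p.1 p.2, bound (enum i) p.1 p.2)) i
  have hs : ∀ i, s (i + 1) =
      (next (enum i) (s i).1 (s i).2, bound (enum i) (s i).1 (s i).2) := fun i => rfl
  have hmono : StrictMono fun i => (s i).2 := by
    refine strictMono_nat_of_lt_succ fun i => ?_
    rw [hs]
    exact hlt _ _ _
  have hstable : ∀ i d, ∀ j < (s i).2, (s (i + d)).1.gate j = (s i).1.gate j := by
    intro i d
    induction d with
    | zero => intro j _; rfl
    | succ d ih =>
      intro j hj
      rw [← add_assoc, hs, hagree _ _ _ j (hj.trans_le (hmono.monotone (Nat.le_add_right i d))),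
        ih j hj]
  -- The limit oracle takes gate `n` from stage `n + 1`: the bounds increase strictly from `0`, so
  -- this gate is frozen by then.
  let B : GroupOracle := ⟨fun n => (s (n + 1)).1.gate n, fun n => (s (n + 1)).1.exists_group n⟩
  have hB : ∀ i, ∀ j < (s i).2, B.gate j = (s i).1.gate j := by
    intro i j hj
    have hj' : j < (s (j + 1)).2 := Nat.lt_of_succ_le (hmono.le_apply (x := j + 1))
    rcases le_total i (j + 1) with hle | hle
    · obtain ⟨d, hd⟩ := Nat.exists_eq_add_of_le hle
      change (s (j + 1)).1.gate j = _
      rw [hd, hstable i d j hj]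
    · obtain ⟨d, hd⟩ := Nat.exists_eq_add_of_le hle
      change (s (j + 1)).1.gate j = _
      rw [hd, hstable (j + 1) d j hj']
  refine ⟨B, fun e => ?_⟩
  obtain ⟨i, rfl⟩ := henum e
  exact hbad (enum i) (s i).1 (s i).2 B fun j hj => hB (i + 1) j hj

end BlackBox

theorem theorem3 : ∃ B : BlackBox.GroupOracle, BlackBox.GNM B ∉ BlackBox.MA B := by
  have := BlackBox.countable_polynomial_nat
  obtain ⟨B, hB⟩ := BlackBox.exists_forall_of_forall_extension
    (E := BlackBox.OracleTM × ℕ[X] × {q : ℕ[X] // q ≠ 0} × ℕ[X])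
    (fun e B => BlackBox.Verifies B (BlackBox.GNM B) e.1 e.2.1 e.2.2.1 e.2.2.2)
    (fun e B m => BlackBox.exists_not_verifies B m e.1 e.2.1 e.2.2.1 e.2.2.2 e.2.2.1.2)
  refine ⟨B, ?_⟩
  rintro ⟨R, q, r, ⟨M, t, hM⟩, hq, hR⟩
  exact hB (M, t, ⟨q, hq⟩, r) ⟨R, hM, hR⟩
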